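/- Let $q\ge 1$ and $g\ge 0$ be integers. Let $\mathcal G_q(0)$ be the complete graph on $q+2$ vertices, and let $\mathcal G_q(g+1)$ be obtained from $\mathcal G_q(g)$ by adding, for every edge of $\mathcal G_q(g)$, a new complete graph on $q$ vertices and joining each of these $q$ vertices to both end nodes of that edge (the edges of $\mathcal G_q(g)$ are kept). For vertices $i,j$ of $\mathcal G_q(g)$ let $d_i$ be the degree of $i$, and let $T_{ij}$ be the hitting time, that is, the expected number of jumps that the simple random walk on $\mathcal G_q(g)$ (each jump goes to a uniformly chosen neighbour) started at $i$ needs to reach $j$ for the first time, with $T_{ii}=0$. Then every $T_{ij}$ is finite, and the multiplicative-degree sum of hitting times $H^{*}_g=\sum_{i}\sum_{j} d_i d_j T_{ij}$, taken over all ordered pairs of vertices of $\mathcal G_q(g)$, equals $$ \begin{aligned} H^{*}_g={}&-\frac{(q+2)(q+4)(q+1)^3}{2}\left(\frac{(q+2)^2(q+1)^3}{4}\right)^{g} +\frac{(q+2)^2(q+1)^3}{q+3}\left(\frac{(q+1)(q+2)}{2}\right)^{2g}\\ &+\frac{(3q+7)(q+2)^2(q+1)^3}{2(q+3)}\left(\frac{(q+1)(q+2)}{2}\right)^{3g}.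 \end{aligned} $$ -/

import Mathlib

open MeasureTheory ProbabilityTheory
open scoped ENNReal

/-! ### Edge corona product and the networks `G_q(g)` -/

section EdgeCorona

variable {V W : Type}

/-- Adjacency of the edge corona product: the vertices are those of `G` together with one copy of
the vertices of `H` for each edge `e` of `G`. The edges of `G` are kept, each copy carries the
edges of `H`, and every vertex of the copy attached to `e` is joined to both end nodes of `e`. -/
def edgeCoronaAdj (G : SimpleGraph V) (H : SimpleGraph W) :
    V ⊕ (G.edgeSet × W) → V ⊕ (G.edgeSet × W) → Prop
  | Sum.inl u, Sum.inl v => G.Adj u v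
  | Sum.inl u, Sum.inr (e, _) => u ∈ (e : Sym2 V)
  | Sum.inr (e, _), Sum.inl u => u ∈ (e : Sym2 V)
  | Sum.inr (e, i), Sum.inr (f, j) => e = f ∧ H.Adj i j

/-- The edge corona product of `G` and `H`. -/
def edgeCorona (G : SimpleGraph V) (H : SimpleGraph W) : SimpleGraph (V ⊕ (G.edgeSet × W)) where
  Adj := edgeCoronaAdj G H
  symm := ⟨by
    rintro (u | ⟨e, i⟩) (v | ⟨f, j⟩) h
    · exact SimpleGraph.Adj.symm h
    · exact h
    · exact h
    · exact ⟨h.1.symm, SimpleGraph.Adj.symm h.2⟩⟩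
  loopless := ⟨by
    rintro (u | ⟨e, i⟩) h
    · exact G.irrefl h
    · exact H.irrefl h.2⟩

end EdgeCorona

/-- The vertex set together with the graph `G_q(g)`: `G_q(0)` is the complete graph on `q + 2`
vertices, and `G_q(g + 1)` is the edge corona product of `G_q(g)` with the complete graph on `q`
vertices. -/
def simplicialNetwork (q : ℕ) : ℕ → (V : Type) × SimpleGraph V
  | 0 => ⟨Fin (q + 2), ⊤⟩
  | g + 1 => ⟨_, edgeCorona (simplicialNetwork q g).2 (⊤ : SimpleGraph (Fin q))⟩

/-- The vertex set of `G_q(g)`. -/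
def NetVertex (q g : ℕ) : Type := (simplicialNetwork q g).1

/-- The graph `G_q(g)`. -/
def netGraph (q g : ℕ) : SimpleGraph (NetVertex q g) := (simplicialNetwork q g).2

theorem finite_netVertex (q g : ℕ) : Finite (NetVertex q g) := by
  induction g with
  | zero => exact inferInstanceAs (Finite (Fin (q + 2)))
  | succ g ih =>
    have h1 : Finite (simplicialNetwork q g).1 := ih
    have h2 : Finite (simplicialNetwork q g).2.edgeSet := Subtype.finite
    exact inferInstanceAs
      (Finite ((simplicialNetwork q g).1 ⊕ ((simplicialNetwork q g).2.edgeSet × Fin q)))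

noncomputable instance (q g : ℕ) : Fintype (NetVertex q g) :=
  @Fintype.ofFinite _ (finite_netVertex q g)

instance (q g : ℕ) : MeasurableSpace (NetVertex q g) := ⊤

instance (q g : ℕ) : DiscreteMeasurableSpace (NetVertex q g) := ⟨fun _ => trivial⟩

/-! ### Random walk and hitting times -/

section RandomWalk

variable {V : Type} [Fintype V]

open scoped Classical in
/-- The degree of a vertex. -/
noncomputable def deg (G : SimpleGraph V) (v : V) : ℕ := G.degree v

open scoped Classical in
/-- One step of the unbiased random walk on `G` from `v`: a uniformly chosen neighbour of `v`
(an isolated vertex is never left). -/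
noncomputable def walkStep (G : SimpleGraph V) (v : V) : PMF V :=
  if h : (G.neighborFinset v).Nonempty then PMF.uniformOfFinset (G.neighborFinset v) h
  else PMF.pure v

variable [MeasurableSpace V] [DiscreteMeasurableSpace V]

/-- The transition kernel of the random walk at time `n`, as a function of the path up to
time `n`, of which only the current position matters. -/
noncomputable def walkKernel (G : SimpleGraph V) (n : ℕ) :
    Kernel ((i : Finset.Iic n) → (fun _ : ℕ => V) i) V where
  toFun x := (walkStep G (x ⟨n, Finset.mem_Iic.2 le_rfl⟩)).toMeasure
  measurable' := (Measurable.of_discrete (f := fun v => (walkStep G v).toMeasure)).comp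
    (measurable_pi_apply _)

instance (G : SimpleGraph V) (n : ℕ) : IsMarkovKernel (walkKernel G n) :=
  ⟨fun x => inferInstanceAs
    (IsProbabilityMeasure (walkStep G (x ⟨n, Finset.mem_Iic.2 le_rfl⟩)).toMeasure)⟩

/-- The law, on the space of infinite trajectories, of the random walk on `G` started at `i`. -/
noncomputable def walkMeasure (G : SimpleGraph V) (i : V) : Measure (ℕ → V) :=
  Kernel.traj (X := fun _ => V) (walkKernel G) 0 (fun _ => i)

/-- The hitting time `T_ij`: the expected number of jumps needed by the random walk started at `i`
to reach `j` for the first time. It is `∞` if this expectation is infinite. -/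
noncomputable def hittingTime (G : SimpleGraph V) (i j : V) : ℝ≥0∞ :=
  ∫⁻ ω, ENat.toENNReal (hittingAfter (fun (n : ℕ) (ω : ℕ → V) => ω n) {j} 0 ω) ∂(walkMeasure G i)

/-- The multiplicative-degree sum of hitting times, over all ordered pairs of vertices. -/
noncomputable def multDegreeHittingSum (G : SimpleGraph V) : ℝ :=
  ∑ i : V, ∑ j : V, ((deg G i : ℝ) * (deg G j : ℝ)) * (hittingTime G i j).toReal

end RandomWalk

/-! The hitting times to a fixed target solve a linear system (degree times value = degree + sum
over neighbours, away from the target), and a finite nonnegative solution is the hitting time, so it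
suffices to exhibit solutions. Summing the system over all vertices extends it to the target with a
source term 2m, m being the number of edges. By the maximum principle a harmonic function is then
constant, so S = ∑_j d_j T_ij does not depend on i, and the required sum is 2mS.

The edge corona with a q-clique has explicit hitting times in terms of the old ones
(`isHittingSystem_corona`). Summing them from an old vertex needs the commute times summed over
edges, which is 2m(n-1) for n vertices (Foster's identity). Hence (n, m, S) determines the next
triple (`HasWalkData.corona`), with S' = (q+1)^2((q+2)S/2 + qm(3m-n)/2). Starting from the complete
graph, this recursion is solved in closed form by induction on g. -/

/-! ### Hitting time as a sum of avoidance indicators -/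

section Avoiding

variable {V : Type}

/-- The paths that avoid `j` up to and including time `n`. -/
def avoiding (j : V) (n : ℕ) : Set (ℕ → V) := {ω | ∀ k ≤ n, ω k ≠ j}

theorem measurableSet_avoiding [MeasurableSpace V] [DiscreteMeasurableSpace V]
    (j : V) (n : ℕ) : MeasurableSet (avoiding j n) := by
  have : avoiding j n = ⋂ k ∈ Set.Iic n, (fun ω : ℕ → V => ω k) ⁻¹' {j}ᶜ := by
    ext ω; simp [avoiding]
  rw [this]
  exact MeasurableSet.biInter (Set.to_countable _)
    fun k _ => measurable_pi_apply k (MeasurableSet.of_discrete)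

/-- A time T is the sum over n of the indicators of T > n. If j is never reached, T is infinite and
every indicator is 1. -/
theorem hittingAfter_eq_tsum (j : V) (ω : ℕ → V) :
    ENat.toENNReal (hittingAfter (fun (n : ℕ) (ω : ℕ → V) => ω n) {j} 0 ω) =
      ∑' n, (avoiding j n).indicator (fun _ => (1 : ℝ≥0∞)) ω := by
  classical
  simp only [hittingAfter_def, zero_le, true_and, Set.mem_singleton_iff]
  by_cases h : ∃ k, ω k = j
  · rw [if_pos h]
    set N := sInf {k | ω k = j} with hN
    have hNj : ω N = j := Nat.sInf_mem (s := {k | ω k = j}) h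
    have hlt : ∀ k < N, ω k ≠ j := fun k hk hkj => Nat.notMem_of_lt_sInf hk hkj
    have : ∀ n, (avoiding j n).indicator (fun _ => (1 : ℝ≥0∞)) ω =
        if n ∈ Finset.range N then 1 else 0 := by
      intro n
      by_cases hn : n < N
      · rw [Set.indicator_of_mem, if_pos (Finset.mem_range.2 hn)]
        exact fun k hk => hlt k (hk.trans_lt hn)
      · rw [Set.indicator_of_notMem, if_neg (by simpa using hn)]
        exact fun hh => hh N (not_lt.1 hn) hNj
    simp_rw [this]
    rw [tsum_eq_sum (s := Finset.range N) (fun b hb => if_neg hb)]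
    rw [Finset.sum_ite_mem]
    simp
    rfl
  · rw [if_neg h]
    have : ∀ n, (avoiding j n).indicator (fun _ => (1 : ℝ≥0∞)) ω = 1 := by
      intro n
      rw [Set.indicator_of_mem]
      exact fun k _ hk => h ⟨k, hk⟩
    simp_rw [this]
    rw [ENNReal.tsum_const_eq_top_of_ne_zero one_ne_zero]
    rfl

end Avoiding

/-! ### Markov property and the hitting time equations -/

section HittingTimeEquation

variable {V : Type} [Fintype V] [MeasurableSpace V] [DiscreteMeasurableSpace V]

/-- The Markov property of the walk at time `n`, in integrated form. -/
theorem lintegral_walkMeasure_succ (G : SimpleGraph V) (i : V) (n : ℕ)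
    {F : (Finset.Iic n → V) → ℝ≥0∞} (hF : Measurable F) (f : V → ℝ≥0∞) :
    ∫⁻ ω, F (Preorder.frestrictLe n ω) * f (ω (n + 1)) ∂(walkMeasure G i) =
      ∫⁻ ω, F (Preorder.frestrictLe n ω) * ∫⁻ w, f w ∂(walkStep G (ω n)).toMeasure
        ∂(walkMeasure G i) := by
  have hf : Measurable f := Measurable.of_discrete
  have hmf : Measurable fun v => ∫⁻ w, f w ∂(walkStep G v).toMeasure := Measurable.of_discrete
  have hfr : Measurable (Preorder.frestrictLe (π := fun _ : ℕ => V) n) :=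
    Preorder.measurable_frestrictLe n
  have hL : Measurable fun ω : ℕ → V => F (Preorder.frestrictLe n ω) * f (ω (n + 1)) :=
    (hF.comp hfr).mul (hf.comp (measurable_pi_apply _))
  have hR : Measurable fun x : Finset.Iic n → V => F x *
      ∫⁻ w, f w ∂(walkStep G (x ⟨n, Finset.mem_Iic.2 le_rfl⟩)).toMeasure :=
    hF.mul (hmf.comp (measurable_pi_apply _))
  have key : ∀ x : Finset.Iic n → V,
      ∫⁻ ω, F (Preorder.frestrictLe n ω) * f (ω (n + 1))
        ∂(Kernel.traj (X := fun _ => V) (walkKernel G) n x) =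
      F x * ∫⁻ w, f w ∂(walkStep G (x ⟨n, Finset.mem_Iic.2 le_rfl⟩)).toMeasure := by
    intro x
    -- Given the prefix x, the trajectory is integrated with its first coordinates overwritten by x:
    -- the factor F becomes constant, and coordinate n + 1 has the law of one step.
    rw [Kernel.lintegral_traj x hL]
    have h1 : ∀ ω : ℕ → V, F (Preorder.frestrictLe (π := fun _ : ℕ => V) n
        (Function.updateFinset ω (Finset.Iic n) x)) *
        f (Function.updateFinset ω (Finset.Iic n) x (n + 1)) = F x * f (ω (n + 1)) := by
      intro ω
      congr 2
      · ext k
        simp [Function.updateFinset]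
      · simp [Function.updateFinset]
    simp_rw [h1]
    rw [lintegral_const_mul _ (f := fun ω : ℕ → V => f (ω (n + 1)))
      (hf.comp (measurable_pi_apply _))]
    congr 1
    have h2 := Kernel.map_traj_succ_self (X := fun _ => V) (κ := walkKernel G) (a := n)
    have h3 := congrArg (fun κ => κ x) h2
    rw [Kernel.map_apply _ (measurable_pi_apply _)] at h3
    rw [← lintegral_map (g := fun ω : ℕ → V => ω (n + 1)) hf (measurable_pi_apply _), h3]
    rfl
  have hcomp := Kernel.traj_comp_partialTraj (X := fun _ => V) (κ := walkKernel G) (Nat.zero_le n)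
  calc _ = ∫⁻ x, (∫⁻ ω, F (Preorder.frestrictLe n ω) * f (ω (n + 1))
        ∂(Kernel.traj (X := fun _ => V) (walkKernel G) n x))
        ∂(Kernel.partialTraj (X := fun _ => V) (walkKernel G) 0 n (fun _ => i)) := by
        unfold walkMeasure
        rw [← hcomp, Kernel.lintegral_comp _ _ _ hL]
    _ = _ := by
        simp_rw [key]
        rw [← Kernel.traj_map_frestrictLe_apply, lintegral_map hR hfr]
        rfl

theorem walkMeasure_zero (G : SimpleGraph V) (i : V) :
    ∀ᵐ ω ∂(walkMeasure G i), ω 0 = i := by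
  have h : (walkMeasure G i).map (Preorder.frestrictLe (π := fun _ : ℕ => V) 0) =
      Measure.dirac (fun _ => i) := by
    unfold walkMeasure
    rw [Kernel.traj_map_frestrictLe_apply, Kernel.partialTraj_self, Kernel.id_apply]
  have h2 : ∀ᵐ x ∂((walkMeasure G i).map (Preorder.frestrictLe (π := fun _ : ℕ => V) 0)),
      x ⟨0, Finset.mem_Iic.2 le_rfl⟩ = i := by
    rw [h, ae_dirac_eq]
    rfl
  exact ae_of_ae_map (Preorder.measurable_frestrictLe 0).aemeasurable h2

instance (G : SimpleGraph V) (i : V) : IsProbabilityMeasure (walkMeasure G i) := by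
  unfold walkMeasure; infer_instance

/-- A finite solution of the hitting time equations is the hitting time. -/
theorem hittingTime_eq_of_equation (G : SimpleGraph V) (j : V) (H : V → ℝ≥0∞)
    (hfin : ∀ i, H i ≠ ∞) (hj : H j = 0)
    (hH : ∀ i, i ≠ j → H i = 1 + ∫⁻ w, H w ∂(walkStep G i).toMeasure) (i : V) :
    hittingTime G i j = H i := by
  classical
  set μ := walkMeasure G i with hμ
  have hmH : ∀ n, Measurable fun ω : ℕ → V => H (ω n) := fun n =>
    (Measurable.of_discrete (f := H)).comp (measurable_pi_apply _)
  -- `e n` is the expected remaining time H(ω n) on the event that j is still unvisited. It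
  -- telescopes against the probabilities of avoidance, whose sum is the hitting time.
  set e : ℕ → ℝ≥0∞ := fun n => ∫⁻ ω, (avoiding j n).indicator (fun ω => H (ω n)) ω ∂μ with he
  have hT : hittingTime G i j = ∑' n, μ (avoiding j n) := by
    unfold hittingTime
    simp_rw [hittingAfter_eq_tsum]
    rw [lintegral_tsum fun n =>
      (measurable_const.indicator (measurableSet_avoiding j n)).aemeasurable]
    congr 1
    ext n
    rw [lintegral_indicator (measurableSet_avoiding j n)]
    simp [hμ]
  have hsucc : ∀ n, e n = μ (avoiding j n) + e (n + 1) := by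
    intro n
    -- Since H vanishes at j, paths first reaching j at time n + 1 contribute nothing, so the event
    -- up to time n may be used.
    have h1 : e (n + 1) = ∫⁻ ω, (avoiding j n).indicator (fun ω => H (ω (n + 1))) ω ∂μ := by
      refine lintegral_congr fun ω => ?_
      by_cases hω : ω (n + 1) = j
      · have : ω ∉ avoiding j (n + 1) := fun h => h _ le_rfl hω
        rw [Set.indicator_of_notMem this]
        by_cases h' : ω ∈ avoiding j n
        · rw [Set.indicator_of_mem h', hω, hj]
        · rw [Set.indicator_of_notMem h']
      · by_cases h' : ω ∈ avoiding j n
        · have : ω ∈ avoiding j (n + 1) := by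
            intro k hk
            rcases Nat.le_succ_iff.1 hk with hk | rfl
            · exact h' k hk
            · exact hω
          rw [Set.indicator_of_mem this, Set.indicator_of_mem h']
        · have : ω ∉ avoiding j (n + 1) := fun h => h' fun k hk => h k (hk.trans n.le_succ)
          rw [Set.indicator_of_notMem this, Set.indicator_of_notMem h']
    let F : (Finset.Iic n → V) → ℝ≥0∞ := fun x => if ∀ k, x k ≠ j then 1 else 0
    have hF : Measurable F := Measurable.of_discrete
    have hFω : ∀ (ω : ℕ → V) (c : ℝ≥0∞), F (Preorder.frestrictLe n ω) * c =
        (avoiding j n).indicator (fun _ => c) ω := by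
      intro ω c
      have : (∀ k : Finset.Iic n, Preorder.frestrictLe (π := fun _ : ℕ => V) n ω k ≠ j) ↔
          ω ∈ avoiding j n := by
        simp [avoiding]
      simp only [F, this]
      by_cases h : ω ∈ avoiding j n <;> simp [h]
    have h2 := lintegral_walkMeasure_succ G i n hF H
    simp_rw [hFω] at h2
    have h3 : e (n + 1) = ∫⁻ ω, (avoiding j n).indicator
        (fun _ => ∫⁻ w, H w ∂(walkStep G (ω n)).toMeasure) ω ∂μ := by
      rw [h1, ← h2]
      rfl
    have h4 : μ (avoiding j n) = ∫⁻ ω, (avoiding j n).indicator (fun _ => 1) ω ∂μ := by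
      rw [lintegral_indicator (measurableSet_avoiding j n)]; simp
    rw [h3, h4, ← lintegral_add_left (measurable_const.indicator (measurableSet_avoiding j n))]
    refine lintegral_congr fun ω => ?_
    by_cases h : ω ∈ avoiding j n
    · simp only [Set.indicator_of_mem h]
      exact hH _ (h n le_rfl)
    · simp only [Set.indicator_of_notMem h, add_zero]
  have h0 : e 0 = H i := by
    have : e 0 = ∫⁻ _, H i ∂μ := by
      refine lintegral_congr_ae ?_
      filter_upwards [walkMeasure_zero G i] with ω hω
      by_cases h : ω ∈ avoiding j 0
      · rw [Set.indicator_of_mem h, hω]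
      · rw [Set.indicator_of_notMem h]
        have : ω 0 = j := by simpa [avoiding] using h
        rw [← hω, this, hj]
    rw [this]
    simp
  have hsum : ∀ n, H i = ∑ k ∈ Finset.range n, μ (avoiding j k) + e n := by
    intro n
    induction n with
    | zero => simp [h0]
    | succ n ih => rw [ih, Finset.sum_range_succ, add_assoc, ← hsucc]
  have hne : ∑' n, μ (avoiding j n) ≠ ∞ := by
    refine ne_top_of_le_ne_top (hfin i) (ENNReal.tsum_le_of_sum_range_le fun n => ?_)
    rw [hsum n]
    exact le_self_add
  -- H is bounded on the finite vertex set and the avoidance probabilities are summable, so the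
  -- remainder `e n` tends to 0.
  have hbd : ∀ n, e n ≤ (∑ v, H v) * μ (avoiding j n) := by
    intro n
    rw [← lintegral_indicator_const (measurableSet_avoiding j n)]
    refine lintegral_mono fun ω => ?_
    by_cases h : ω ∈ avoiding j n
    · simp only [Set.indicator_of_mem h]
      exact Finset.single_le_sum (f := H) (fun _ _ => zero_le) (Finset.mem_univ _)
    · simp only [Set.indicator_of_notMem h, le_refl]
  have he0 : Filter.Tendsto e Filter.atTop (nhds 0) := by
    have h1 := ENNReal.Tendsto.const_mul (a := ∑ v, H v)
      (ENNReal.tendsto_atTop_zero_of_tsum_ne_top hne)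
      (Or.inr (ENNReal.sum_ne_top.2 fun v _ => hfin v))
    rw [mul_zero] at h1
    exact tendsto_of_tendsto_of_tendsto_of_le_of_le tendsto_const_nhds h1
      (fun _ => zero_le) hbd
  have hlim := (ENNReal.tendsto_nat_tsum fun n => μ (avoiding j n)).add he0
  rw [add_zero] at hlim
  rw [hT]
  refine tendsto_nhds_unique hlim ?_
  simp_rw [← hsum]
  exact tendsto_const_nhds

end HittingTimeEquation

/-! ### Neighbour sums and one step of the walk -/

section NeighbourSum

variable {V : Type} [Fintype V]

open scoped Classical in
/-- The sum of `F` over the neighbours of `i`. -/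
noncomputable def nbrSum (G : SimpleGraph V) (F : V → ℝ) (i : V) : ℝ :=
  ∑ k, if G.Adj i k then F k else 0

theorem nbrSum_add (G : SimpleGraph V) (F F' : V → ℝ) (i : V) :
    nbrSum G (fun k => F k + F' k) i = nbrSum G F i + nbrSum G F' i := by
  simp only [nbrSum, ← Finset.sum_add_distrib]
  exact Finset.sum_congr rfl fun k _ => by split_ifs <;> simp

theorem nbrSum_const_mul (G : SimpleGraph V) (c : ℝ) (F : V → ℝ) (i : V) :
    nbrSum G (fun k => c * F k) i = c * nbrSum G F i := by
  simp only [nbrSum, Finset.mul_sum, mul_ite, mul_zero]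

theorem deg_eq_nbrSum (G : SimpleGraph V) (i : V) : (deg G i : ℝ) = nbrSum G (fun _ => 1) i := by
  classical
  simp only [deg, nbrSum, Finset.sum_boole]
  congr 1
  rw [← SimpleGraph.card_neighborFinset_eq_degree]
  congr 1
  ext k
  simp

theorem nbrSum_const (G : SimpleGraph V) (c : ℝ) (i : V) :
    nbrSum G (fun _ => c) i = c * deg G i := by
  rw [deg_eq_nbrSum, ← nbrSum_const_mul]; simp

theorem nbrSum_mono (G : SimpleGraph V) {F F' : V → ℝ} (h : ∀ k, F k ≤ F' k) (i : V) :
    nbrSum G F i ≤ nbrSum G F' i :=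
  Finset.sum_le_sum fun k _ => by split_ifs <;> simp [h k]

theorem nbrSum_sum {ι : Type*} (G : SimpleGraph V) (s : Finset ι) (F : ι → V → ℝ) (i : V) :
    nbrSum G (fun k => ∑ a ∈ s, F a k) i = ∑ a ∈ s, nbrSum G (F a) i := by
  simp only [nbrSum]
  rw [Finset.sum_comm]
  exact Finset.sum_congr rfl fun k _ => by split_ifs <;> simp

theorem sum_nbrSum_swap (G : SimpleGraph V) (F : V → V → ℝ) :
    ∑ i, nbrSum G (F i) i = ∑ i, nbrSum G (fun k => F k i) i := by
  simp only [nbrSum]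
  rw [Finset.sum_comm]
  exact Finset.sum_congr rfl fun i _ => Finset.sum_congr rfl fun k _ => by
    by_cases hik : G.Adj i k <;> simp [hik, G.adj_comm k i]

theorem sum_nbrSum (G : SimpleGraph V) (F : V → ℝ) :
    ∑ i, nbrSum G F i = ∑ i, deg G i * F i := by
  rw [sum_nbrSum_swap G fun _ k => F k]
  simp only [nbrSum_const, mul_comm]

theorem lintegral_walkStep [MeasurableSpace V] [DiscreteMeasurableSpace V] (G : SimpleGraph V)
    (i : V) (hi : 0 < deg G i) (F : V → ℝ) (hF : ∀ k, 0 ≤ F k) :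
    ∫⁻ w, ENNReal.ofReal (F w) ∂(walkStep G i).toMeasure =
      ENNReal.ofReal (nbrSum G F i / deg G i) := by
  classical
  have hne : (G.neighborFinset i).Nonempty := by
    rw [← Finset.card_pos]
    unfold deg at hi
    convert hi using 1
    rw [← SimpleGraph.card_neighborFinset_eq_degree]
  have hcard : ((G.neighborFinset i).card : ℝ) = deg G i := by
    unfold deg
    rw [← SimpleGraph.card_neighborFinset_eq_degree]
  have hpos : (0 : ℝ) < deg G i := by exact_mod_cast hi
  have hstep : ∀ w, walkStep G i w = ENNReal.ofReal (if G.Adj i w then (deg G i : ℝ)⁻¹ else 0) := by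
    intro w
    have h1 : walkStep G i = PMF.uniformOfFinset (G.neighborFinset i) hne := by
      unfold walkStep
      rw [dif_pos hne]
    rw [h1, PMF.uniformOfFinset_apply]
    simp only [SimpleGraph.mem_neighborFinset]
    split_ifs with h
    · rw [ENNReal.ofReal_inv_of_pos hpos, ← hcard, ENNReal.ofReal_natCast]
    · simp
  rw [lintegral_fintype]
  simp only [PMF.toMeasure_apply_singleton _ _ (measurableSet_singleton _), hstep,
    ← ENNReal.ofReal_mul (hF _)]
  rw [← ENNReal.ofReal_sum_of_nonneg]
  · congr 1
    simp only [nbrSum, div_eq_mul_inv, Finset.sum_mul]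
    exact Finset.sum_congr rfl fun k _ => by split_ifs <;> simp
  · intro k _
    refine mul_nonneg (hF k) ?_
    split_ifs <;> positivity

end NeighbourSum

/-! ### Maximum principle, return times and the random target identity -/

section HittingSystem

variable {V : Type} [Fintype V]

/-- `h` solves the hitting time equations of the random walk on `G`. -/
structure IsHittingSystem (G : SimpleGraph V) (h : V → V → ℝ) : Prop where
  diag : ∀ j, h j j = 0
  step : ∀ i j, i ≠ j → deg G i * h i j = deg G i + nbrSum G (fun k => h k j) i

namespace IsHittingSystem

variable {G : SimpleGraph V} {h : V → V → ℝ}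

/-- The maximum principle off `j`. -/
theorem le_of_subharmonic {j : V} {φ : V → ℝ}
    (hφ : ∀ i, i ≠ j → deg G i * φ i < nbrSum G φ i) (i : V) : φ i ≤ φ j := by
  obtain ⟨x, -, hx⟩ := Finset.exists_max_image Finset.univ φ ⟨j, Finset.mem_univ j⟩
  have hx' : ∀ y, φ y ≤ φ x := fun y => hx y (Finset.mem_univ y)
  by_cases hxj : x = j
  · exact hxj ▸ hx' i
  · have h1 := hφ x hxj
    have h2 := nbrSum_mono G hx' x
    rw [nbrSum_const] at h2
    linarith [mul_comm (φ x) (deg G x : ℝ)]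

/-- Positivity of the degrees makes -h strictly subharmonic off j, so the maximum principle applies
to it. -/
theorem nonneg (hh : IsHittingSystem G h) (hG : ∀ i, 0 < deg G i) (i j : V) : 0 ≤ h i j := by
  have := le_of_subharmonic (j := j) (φ := fun k => (-1) * h k j) (fun i hi => by
    rw [nbrSum_const_mul]
    have h1 := hh.step i j hi
    have h2 : (0 : ℝ) < deg G i := by exact_mod_cast hG i
    linarith) i
  have h0 := hh.diag j
  linarith

theorem hittingTime_eq [MeasurableSpace V] [DiscreteMeasurableSpace V]
    (hh : IsHittingSystem G h) (hG : ∀ i, 0 < deg G i) (i j : V) :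
    hittingTime G i j = ENNReal.ofReal (h i j) := by
  refine hittingTime_eq_of_equation G j (fun i => ENNReal.ofReal (h i j))
    (fun _ => ENNReal.ofReal_ne_top) (by simp [hh.diag]) (fun i hi => ?_) i
  have hpos : (0 : ℝ) < deg G i := by exact_mod_cast hG i
  have hn : 0 ≤ nbrSum G (fun k => h k j) i := by
    have := nbrSum_mono G (F := fun _ => 0) (fun k => hh.nonneg hG k j) i
    rwa [nbrSum_const, zero_mul] at this
  rw [lintegral_walkStep G i (hG i) (fun k => h k j) fun k => hh.nonneg hG k j,
    ← ENNReal.ofReal_one, ← ENNReal.ofReal_add zero_le_one (div_nonneg hn hpos.le)]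
  congr 1
  have := hh.step i j hi
  field_simp
  linarith

open scoped Classical in
/-- The hitting time equations, extended to the target by the expected return time. -/
theorem step_all (hh : IsHittingSystem G h) (i j : V) :
    deg G i * h i j = deg G i + nbrSum G (fun k => h k j) i
      - if i = j then ∑ k, (deg G k : ℝ) else 0 := by
  by_cases hij : i = j
  · subst hij
    -- Degree times value minus neighbour sum has total 0 over all vertices, so the equations off
    -- the target force the one at the target.
    have h1 := sum_nbrSum G fun k => h k i
    rw [← Finset.add_sum_erase _ _ (Finset.mem_univ i),
      ← Finset.add_sum_erase _ (fun k => (deg G k : ℝ) * h k i) (Finset.mem_univ i),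
      Finset.sum_congr rfl fun k hk => hh.step k i (Finset.ne_of_mem_erase hk),
      Finset.sum_add_distrib, hh.diag] at h1
    rw [if_pos rfl, ← Finset.add_sum_erase _ _ (Finset.mem_univ i), hh.diag]
    linarith
  · rw [if_neg hij, hh.step i j hij, sub_zero]

/-- Subtracting a small multiple s of h(·, j) makes φ strictly subharmonic off j, giving φ i ≤ φ j +
s h(i, j); let s tend to 0. The existence of h replaces a connectedness assumption. -/
theorem harmonic_eq (hh : IsHittingSystem G h) (hG : ∀ i, 0 < deg G i) {φ : V → ℝ}
    (hφ : ∀ i, deg G i * φ i = nbrSum G φ i) (i j : V) : φ i = φ j := by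
  have key : ∀ i j, φ i ≤ φ j := by
    intro i j
    refine le_of_forall_pos_le_add fun t ht => ?_
    have hs : 0 < t / (1 + |h i j|) := by positivity
    have := le_of_subharmonic (j := j)
      (φ := fun k => φ k + (-(t / (1 + |h i j|))) * h k j) (fun x hx => by
        rw [nbrSum_add, nbrSum_const_mul, ← hφ]
        have h1 := hh.step x j hx
        have h2 : (0 : ℝ) < deg G x := by exact_mod_cast hG x
        have h3 := mul_pos hs h2
        linear_combination h3 + (-(t / (1 + |h i j|))) * h1) i
    simp only [hh.diag] at this
    have h4 : t / (1 + |h i j|) * h i j ≤ t := by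
      rw [div_mul_eq_mul_div, div_le_iff₀ (by positivity)]
      nlinarith [le_abs_self (h i j)]
    linarith
  exact le_antisymm (key i j) (key j i)

/-- The degree-weighted sum of the hitting times from `i` does not depend on `i`. -/
theorem sum_deg_mul_eq (hh : IsHittingSystem G h) (hG : ∀ i, 0 < deg G i) (i i' : V) :
    ∑ j, deg G j * h i j = ∑ j, deg G j * h i' j := by
  classical
  refine hh.harmonic_eq hG (φ := fun i => ∑ j, deg G j * h i j) (fun x => ?_) i i'
  rw [nbrSum_sum, Finset.mul_sum]
  -- Summed over j, the terms d_x d_j and the return term d_x ∑ d_k cancel, leaving a harmonic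
  -- function of the start.
  have h1 : ∀ j, (deg G x : ℝ) * (deg G j * h x j) =
      deg G x * deg G j + nbrSum G (fun k => deg G j * h k j) x
        - if x = j then deg G j * ∑ k, (deg G k : ℝ) else 0 := by
    intro j
    rw [nbrSum_const_mul, mul_left_comm, hh.step_all]
    split_ifs <;> ring
  simp only [h1, Finset.sum_sub_distrib, Finset.sum_add_distrib, ← Finset.mul_sum,
    Finset.sum_ite_eq, Finset.mem_univ, if_true]
  ring

end IsHittingSystem

/-- `G` has `n` vertices, `m` edges, no isolated vertices and finite hitting times, and the
degree-weighted sum of the hitting times from any vertex is `S`. -/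
structure HasWalkData (G : SimpleGraph V) (n m S : ℝ) : Prop where
  nonempty : Nonempty V
  card : (Fintype.card V : ℝ) = n
  deg_pos : ∀ i, 0 < deg G i
  sum_deg : ∑ i, (deg G i : ℝ) = 2 * m
  system : ∃ h, IsHittingSystem G h ∧ ∀ i, ∑ j, deg G j * h i j = S

theorem HasWalkData.hittingTime_ne_top [MeasurableSpace V] [DiscreteMeasurableSpace V]
    {G : SimpleGraph V} {n m S : ℝ} (hd : HasWalkData G n m S) (i j : V) :
    hittingTime G i j ≠ ∞ := by
  obtain ⟨h, hh, -⟩ := hd.system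
  rw [hh.hittingTime_eq hd.deg_pos]
  exact ENNReal.ofReal_ne_top

theorem HasWalkData.multDegreeHittingSum_eq [MeasurableSpace V] [DiscreteMeasurableSpace V]
    {G : SimpleGraph V} {n m S : ℝ} (hd : HasWalkData G n m S) :
    multDegreeHittingSum G = 2 * m * S := by
  obtain ⟨h, hh, hS⟩ := hd.system
  simp only [multDegreeHittingSum, hh.hittingTime_eq hd.deg_pos,
    ENNReal.toReal_ofReal (hh.nonneg hd.deg_pos _ _), mul_assoc, ← Finset.mul_sum, hS,
    ← Finset.sum_mul, hd.sum_deg]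

/-- Each step reaches a given other vertex with probability 1/(q+1), so every off-diagonal hitting
time is q + 1. -/
theorem hasWalkData_top (q : ℕ) :
    HasWalkData (⊤ : SimpleGraph (Fin (q + 2))) ((q : ℝ) + 2) (((q : ℝ) + 1) * (q + 2) / 2)
      (((q : ℝ) + 1) ^ 3) := by
  classical
  have hnbr : ∀ (F : Fin (q + 2) → ℝ) i, nbrSum ⊤ F i = ∑ k, F k - F i := by
    intro F i
    calc _ = ∑ k, (F k - if i = k then F k else 0) :=
          Finset.sum_congr rfl fun k _ => by by_cases hk : i = k <;> simp [hk]
      _ = _ := by simp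
  have hdeg : ∀ i : Fin (q + 2), (deg ⊤ i : ℝ) = q + 1 := by
    intro i
    rw [deg_eq_nbrSum, hnbr]
    simp
    ring
  refine ⟨inferInstance, by simp, fun i => ?_, ?_, fun i j => if i = j then 0 else (q + 1 : ℝ),
    ⟨by simp, fun i j hij => ?_⟩, fun i => ?_⟩
  · have : (0 : ℝ) < deg (⊤ : SimpleGraph (Fin (q + 2))) i := by rw [hdeg]; positivity
    exact_mod_cast this
  · simp only [hdeg, Finset.sum_const, Finset.card_univ, Fintype.card_fin, nsmul_eq_mul]
    push_cast
    ring
  · have h1 : ∀ k, (if k = j then (0 : ℝ) else q + 1) = (q + 1) - if k = j then (q + 1 : ℝ) else 0 := by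
      intro k; split_ifs <;> ring
    simp only [hdeg, hnbr, h1, Finset.sum_sub_distrib, Finset.sum_ite_eq', Finset.mem_univ,
      if_true, if_neg hij, Finset.sum_const, Finset.card_univ, Fintype.card_fin, nsmul_eq_mul]
    push_cast
    ring
  · have h1 : ∀ k, (if i = k then (0 : ℝ) else q + 1) = (q + 1) - if i = k then (q + 1 : ℝ) else 0 := by
      intro k; split_ifs <;> ring
    simp only [hdeg, h1, ← Finset.mul_sum, Finset.sum_sub_distrib, Finset.sum_ite_eq,
      Finset.mem_univ, if_true, Finset.sum_const, Finset.card_univ, Fintype.card_fin, nsmul_eq_mul]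
    push_cast
    ring

end HittingSystem

/-! ### Sums over edges and their end nodes -/

section EndSum

variable {V : Type} [Fintype V]

open scoped Classical in
/-- The sum of `F` over the end nodes of `e`. -/
noncomputable def endSum (F : V → ℝ) (e : Sym2 V) : ℝ := ∑ u, if u ∈ e then F u else 0

theorem endSum_mk (F : V → ℝ) {u v : V} (huv : u ≠ v) : endSum F s(u, v) = F u + F v := by
  classical
  calc _ = ∑ x, ((if x = u then F x else 0) + if x = v then F x else 0) := by
        refine Finset.sum_congr rfl fun x _ => ?_
        by_cases h1 : x = u
        · have h2 : x ≠ v := h1 ▸ huv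
          simp [h1, huv]
        · by_cases h2 : x = v
          · simp [h2, huv.symm]
          · simp [h1, h2]
    _ = _ := by simp [Finset.sum_add_distrib]

theorem endSum_add (F F' : V → ℝ) (e : Sym2 V) :
    endSum (fun u => F u + F' u) e = endSum F e + endSum F' e := by
  simp only [endSum, ← Finset.sum_add_distrib]
  exact Finset.sum_congr rfl fun k _ => by split_ifs <;> simp

theorem endSum_const_mul (c : ℝ) (F : V → ℝ) (e : Sym2 V) :
    endSum (fun u => c * F u) e = c * endSum F e := by
  simp only [endSum, Finset.mul_sum, mul_ite, mul_zero]

theorem endSum_const (G : SimpleGraph V) (c : ℝ) (e : G.edgeSet) :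
    endSum (fun _ => c) (e : Sym2 V) = 2 * c := by
  obtain ⟨e, he⟩ := e
  induction e with
  | _ u v =>
    rw [endSum_mk _ (SimpleGraph.Adj.ne he), two_mul]

theorem nbrSum_endSum (G : SimpleGraph V) (F : V → V → ℝ) (e : Sym2 V) (i : V) :
    nbrSum G (fun k => endSum (F k) e) i = endSum (fun v => nbrSum G (fun k => F k v) i) e := by
  classical
  simp only [endSum]
  rw [nbrSum_sum]
  refine Finset.sum_congr rfl fun v _ => ?_
  split_ifs
  · rfl
  · rw [nbrSum_const, zero_mul]

variable (G : SimpleGraph V) [Fintype G.edgeSet]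

open scoped Classical in
theorem sum_edges_incident (F : Sym2 V → ℝ) (u : V) :
    ∑ e : G.edgeSet, (if u ∈ (e : Sym2 V) then F e else 0) = nbrSum G (fun k => F s(u, k)) u := by
  simp only [nbrSum, ← Finset.sum_filter]
  symm
  refine Finset.sum_bij (fun k hk => ⟨s(u, k), (Finset.mem_filter.1 hk).2⟩) ?_ ?_ ?_ ?_
  · intro k hk
    simp
  · intro k hk k' hk' h
    exact Sym2.congr_right.1 (congrArg Subtype.val h)
  · rintro ⟨e, he⟩ h
    obtain ⟨k, rfl⟩ := Sym2.mem_iff_exists.1 (Finset.mem_filter.1 h).2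
    exact ⟨k, by simpa using he, rfl⟩
  · intro k hk
    rfl

open scoped Classical in
theorem sum_edges_incident_endSum (F : V → ℝ) (u : V) :
    ∑ e : G.edgeSet, (if u ∈ (e : Sym2 V) then endSum F e else 0) =
      deg G u * F u + nbrSum G F u := by
  rw [sum_edges_incident, mul_comm, ← nbrSum_const, ← nbrSum_add]
  refine Finset.sum_congr rfl fun k _ => ?_
  split_ifs with h
  · exact endSum_mk F h.ne
  · rfl

/-- Double counting: an edge with a chosen end is a vertex with a chosen neighbour. -/
theorem sum_edges_endSum (F : V → Sym2 V → ℝ) :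
    ∑ e : G.edgeSet, endSum (fun u => F u e) e = ∑ u, nbrSum G (fun k => F u s(u, k)) u := by
  classical
  simp only [endSum]
  rw [Finset.sum_comm]
  exact Finset.sum_congr rfl fun u _ => sum_edges_incident G (F u) u

theorem two_mul_card_edges : 2 * (Fintype.card G.edgeSet : ℝ) = ∑ u, (deg G u : ℝ) := by
  have h := sum_edges_endSum G fun _ _ => 1
  simp only [endSum_const, ← deg_eq_nbrSum] at h
  rw [← h]
  simp [mul_comm]

end EndSum

/-! ### Neighbour sums and degrees in the edge corona -/

section Corona

variable {V : Type} [Fintype V] (G : SimpleGraph V) [Fintype G.edgeSet] (q : ℕ)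

/-- The edge corona product of `G` with the complete graph on `q` vertices. -/
abbrev cliqueCorona : SimpleGraph (V ⊕ (G.edgeSet × Fin q)) :=
  edgeCorona G (⊤ : SimpleGraph (Fin q))

open scoped Classical in
theorem nbrSum_corona_inl (F : V ⊕ (G.edgeSet × Fin q) → ℝ) (u : V) :
    nbrSum (cliqueCorona G q) F (Sum.inl u) = nbrSum G (fun v => F (Sum.inl v)) u +
      ∑ e : G.edgeSet, if u ∈ (e : Sym2 V) then ∑ a, F (Sum.inr (e, a)) else 0 := by
  unfold nbrSum
  rw [Fintype.sum_sum_type, Fintype.sum_prod_type]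
  congr 1
  refine Finset.sum_congr rfl fun e _ => ?_
  by_cases h : u ∈ (e : Sym2 V)
  · rw [if_pos h]
    exact Finset.sum_congr rfl fun a _ => if_pos h
  · rw [if_neg h]
    exact Finset.sum_eq_zero fun a _ => if_neg h

theorem nbrSum_corona_inr (F : V ⊕ (G.edgeSet × Fin q) → ℝ) (e : G.edgeSet) (a : Fin q) :
    nbrSum (cliqueCorona G q) F (Sum.inr (e, a)) =
      endSum (fun v => F (Sum.inl v)) e + (∑ b, F (Sum.inr (e, b)) - F (Sum.inr (e, a))) := by
  classical
  unfold nbrSum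
  rw [Fintype.sum_sum_type, Fintype.sum_prod_type]
  refine congrArg₂ (· + ·) (Finset.sum_congr rfl fun v _ => ?_) ?_
  · by_cases h : v ∈ (e : Sym2 V)
    · exact (if_pos h).trans (if_pos h).symm
    · exact (if_neg h).trans (if_neg h).symm
  have h1 : ∀ f b, (if (cliqueCorona G q).Adj (Sum.inr (e, a)) (Sum.inr (f, b))
      then F (Sum.inr (f, b)) else 0) =
      if e = f then F (Sum.inr (f, b)) - (if a = b then F (Sum.inr (f, b)) else 0) else 0 := by
    intro f b
    have : (cliqueCorona G q).Adj (Sum.inr (e, a)) (Sum.inr (f, b)) ↔ e = f ∧ a ≠ b := Iff.rfl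
    simp only [this]
    by_cases h1 : e = f <;> by_cases h2 : a = b <;> simp [h1, h2]
  calc _ = ∑ f, ∑ b, (if e = f then F (Sum.inr (f, b)) -
        (if a = b then F (Sum.inr (f, b)) else 0) else 0) :=
        Finset.sum_congr rfl fun f _ => Finset.sum_congr rfl fun b _ => by
          rw [← h1 f b]
    _ = _ := by
        rw [Finset.sum_comm]
        simp

theorem deg_corona_inl (u : V) :
    (deg (cliqueCorona G q) (Sum.inl u) : ℝ) = ((q : ℝ) + 1) * deg G u := by
  classical
  rw [deg_eq_nbrSum, nbrSum_corona_inl, ← deg_eq_nbrSum]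
  have := sum_edges_incident G (fun _ => (q : ℝ)) u
  rw [nbrSum_const] at this
  simp only [Finset.sum_const, Finset.card_univ, Fintype.card_fin, nsmul_eq_mul, mul_one]
  rw [this]
  ring

theorem deg_corona_inr (x : G.edgeSet × Fin q) :
    (deg (cliqueCorona G q) (Sum.inr x) : ℝ) = (q : ℝ) + 1 := by
  obtain ⟨e, a⟩ := x
  rw [deg_eq_nbrSum, nbrSum_corona_inr, endSum_const]
  simp
  ring

end Corona

/-! ### Hitting times in the edge corona -/

section CoronaHitting

variable {V : Type} [Fintype V]

/-- The hitting time in the corona of a new vertex attached to `f`, from an old vertex. -/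
noncomputable def coronaToEdge (q : ℕ) (m : ℝ) (h : V → V → ℝ) (f : Sym2 V) (i : V) : ℝ :=
  ((q : ℝ) + 1) / 2 *
    (endSum (h i) f - endSum (fun u => endSum (h u) f) f / 2 + (3 * m - 1))

open scoped Classical in
/-- The hitting times in the corona with a complete graph on `q` vertices of a graph with `m` edges
and hitting times `h`. -/
noncomputable def coronaHitting (G : SimpleGraph V) (q : ℕ) (m : ℝ) (h : V → V → ℝ) :
    V ⊕ (G.edgeSet × Fin q) → V ⊕ (G.edgeSet × Fin q) → ℝ
  | Sum.inl i, Sum.inl j => ((q : ℝ) + 1) * h i j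
  | Sum.inr (e, _), Sum.inl j => ((q : ℝ) + 1) / 2 * (1 + endSum (fun u => h u j) e)
  | Sum.inl i, Sum.inr (f, _) => coronaToEdge q m h f i
  | Sum.inr (e, a), Sum.inr (f, b) =>
      if e = f then if a = b then 0 else ((q : ℝ) + 1) * m
      else ((q : ℝ) + 1) / 2 + endSum (coronaToEdge q m h f) e / 2

variable {G : SimpleGraph V} {h : V → V → ℝ}

/-- The commute time between the ends of f cancels. The additive constant of `coronaToEdge` is
chosen for this value E: with x = (q+1)m between new vertices of one edge, their equation reads 3x =
(q+1) + E. -/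
theorem endSum_coronaToEdge (q : ℕ) (m : ℝ) (f : G.edgeSet) :
    endSum (coronaToEdge q m h f) f = ((q : ℝ) + 1) * (3 * m - 1) := by
  unfold coronaToEdge
  simp only [sub_eq_add_neg]
  rw [endSum_const_mul, endSum_add, endSum_add, endSum_const, endSum_const]
  ring

open scoped Classical in
-- Half the sum of the hitting time equations for the two ends of f: each end carries half of its
-- source 2m.
theorem deg_mul_coronaToEdge (hh : IsHittingSystem G h) (q : ℕ) {m : ℝ}
    (hm : ∑ i, (deg G i : ℝ) = 2 * m) (f : G.edgeSet) (i : V) :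
    deg G i * coronaToEdge q m h f i = nbrSum G (coronaToEdge q m h f) i +
      ((q : ℝ) + 1) * (deg G i - if i ∈ (f : Sym2 V) then m else 0) := by
  have h1 : deg G i * endSum (h i) f = 2 * deg G i + nbrSum G (fun k => endSum (h k) f) i +
      -(if i ∈ (f : Sym2 V) then 2 * m else 0) := by
    have h2 : endSum (fun v => if i = v then -(2 * m) else 0) (f : Sym2 V) =
        -(if i ∈ (f : Sym2 V) then 2 * m else 0) := by
      unfold endSum
      rw [Finset.sum_eq_single i (fun b _ hb => by simp [hb.symm]) (by simp)]
      by_cases hi : i ∈ (f : Sym2 V) <;> simp [hi]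
    rw [← endSum_const_mul, nbrSum_endSum, ← endSum_const G, ← endSum_add, ← h2, ← endSum_add]
    congr 1
    ext v
    rw [hh.step_all, hm]
    split_ifs <;> ring
  have h3 : nbrSum G (coronaToEdge q m h f) i = ((q : ℝ) + 1) / 2 *
      (nbrSum G (fun k => endSum (h k) f) i +
        (-(endSum (fun u => endSum (h u) f) (f : Sym2 V) / 2) + (3 * m - 1)) * deg G i) := by
    unfold coronaToEdge
    simp only [sub_eq_add_neg, add_assoc]
    rw [nbrSum_const_mul, nbrSum_add, nbrSum_const]
  rw [h3]
  unfold coronaToEdge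
  split_ifs at h1 ⊢ <;> linear_combination ((q : ℝ) + 1) / 2 * h1

variable [Fintype G.edgeSet]

/-- From a new vertex, the walk leaves its clique after (q+1)/2 steps on average, at either end of
the edge equally likely. Watched on old vertices only, it is a lazy walk on G, slowed by the factor
q + 1 overall. -/
theorem isHittingSystem_corona (hh : IsHittingSystem G h) (q : ℕ) {m : ℝ}
    (hm : ∑ i, (deg G i : ℝ) = 2 * m) :
    IsHittingSystem (cliqueCorona G q) (coronaHitting G q m h) := by
  classical
  refine ⟨?_, ?_⟩
  · rintro (j | ⟨f, b⟩)
    · simp [coronaHitting, hh.diag]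
    · simp [coronaHitting]
  · rintro (i | ⟨e, a⟩) (j | ⟨f, b⟩) hij
    · have hij' : i ≠ j := fun hc => hij (congrArg Sum.inl hc)
      rw [deg_corona_inl, nbrSum_corona_inl]
      simp only [coronaHitting]
      have h1 : ∀ e : G.edgeSet, (if i ∈ (e : Sym2 V) then
          ∑ _a : Fin q, ((q : ℝ) + 1) / 2 * (1 + endSum (fun u => h u j) e) else 0) =
          (q : ℝ) * ((q + 1) / 2) * ((if i ∈ (e : Sym2 V) then 1 else 0) +
            if i ∈ (e : Sym2 V) then endSum (fun u => h u j) e else 0) := by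
        intro e
        split_ifs <;> simp [mul_assoc]
      simp only [h1]
      rw [← Finset.mul_sum, Finset.sum_add_distrib, sum_edges_incident_endSum,
        sum_edges_incident G (fun _ => 1), ← deg_eq_nbrSum, nbrSum_const_mul]
      linear_combination ((q : ℝ) + 1) * (1 + q / 2) * hh.step i j hij'
    · rw [deg_corona_inl, nbrSum_corona_inl]
      simp only [coronaHitting]
      -- The generic formula is used on every edge and corrected at f: its clique sum 3q(q+1)m/2
      -- there exceeds the true (q-1)(q+1)m by (q+1)(q+2)m/2.
      have h1 : ∀ e : G.edgeSet, (if i ∈ (e : Sym2 V) then ∑ a : Fin q,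
          (if e = f then if a = b then 0 else ((q : ℝ) + 1) * m
            else ((q : ℝ) + 1) / 2 + endSum (coronaToEdge q m h f) e / 2) else 0) =
          (q : ℝ) / 2 * ((if i ∈ (e : Sym2 V) then ((q : ℝ) + 1) else 0) +
            if i ∈ (e : Sym2 V) then endSum (coronaToEdge q m h f) e else 0) -
          if e = f then (if i ∈ (f : Sym2 V) then ((q : ℝ) + 1) * m * (q + 2) / 2 else 0)
            else 0 := by
        intro e
        by_cases hef : e = f
        · subst hef
          have h2 : ∑ a : Fin q, (if a = b then 0 else ((q : ℝ) + 1) * m) =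
              ((q : ℝ) - 1) * ((q + 1) * m) := by
            have h3 : ∀ a : Fin q, (if a = b then 0 else ((q : ℝ) + 1) * m) =
                ((q : ℝ) + 1) * m - if a = b then ((q : ℝ) + 1) * m else 0 := by
              intro a; split_ifs <;> ring
            simp only [h3, Finset.sum_sub_distrib]
            simp
            ring
          simp only [if_true, h2, endSum_coronaToEdge]
          split_ifs <;> ring
        · simp only [if_neg hef]
          split_ifs
          · simp; ring
          · ring
      simp only [h1]
      rw [Finset.sum_sub_distrib, ← Finset.mul_sum, Finset.sum_add_distrib,
        sum_edges_incident_endSum, sum_edges_incident G (fun _ => (q : ℝ) + 1), nbrSum_const,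
        Finset.sum_ite_eq' Finset.univ f, if_pos (Finset.mem_univ _)]
      have h4 := deg_mul_coronaToEdge hh q hm f i
      change _ = _ + (nbrSum G (coronaToEdge q m h f) i + _)
      split_ifs at h4 ⊢ <;> linear_combination (1 + (q : ℝ) / 2) * h4
    · rw [deg_corona_inr, nbrSum_corona_inr]
      simp only [coronaHitting]
      rw [endSum_const_mul]
      simp
      ring
    · rw [deg_corona_inr, nbrSum_corona_inr]
      simp only [coronaHitting]
      by_cases hef : e = f
      · subst hef
        have hab : a ≠ b := fun hc => hij (by rw [hc])
        have h3 : ∀ a : Fin q, (if a = b then 0 else ((q : ℝ) + 1) * m) =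
            ((q : ℝ) + 1) * m - if a = b then ((q : ℝ) + 1) * m else 0 := by
          intro a; split_ifs <;> ring
        have h5 := endSum_coronaToEdge (h := h) q m e
        change _ = _ + (endSum (coronaToEdge q m h e) e + _)
        rw [h5]
        simp only [if_true, h3, Finset.sum_sub_distrib, if_neg hab]
        simp
        ring
      · change _ = _ + (endSum (coronaToEdge q m h f) e + _)
        simp only [if_neg hef]
        simp
        ring

theorem HasWalkData.corona {n m S : ℝ} (hd : HasWalkData G n m S) (q : ℕ) :
    HasWalkData (cliqueCorona G q) (n + q * m) (((q : ℝ) + 1) * (q + 2) / 2 * m)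
      (((q : ℝ) + 1) ^ 2 * ((q + 2) / 2 * S + q * m * (3 * m - n) / 2)) := by
  classical
  obtain ⟨h, hh, hS⟩ := hd.system
  have hE : (Fintype.card G.edgeSet : ℝ) = m := by
    have := two_mul_card_edges G
    rw [hd.sum_deg] at this
    linarith
  have hpos : ∀ x, 0 < deg (cliqueCorona G q) x := by
    rintro (u | x)
    · have h1 := deg_corona_inl G q u
      have h2 : (0 : ℝ) < deg G u := by exact_mod_cast hd.deg_pos u
      have : (0 : ℝ) < deg (cliqueCorona G q) (Sum.inl u) := by rw [h1]; positivity
      exact_mod_cast this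
    · have : (0 : ℝ) < deg (cliqueCorona G q) (Sum.inr x) := by rw [deg_corona_inr]; positivity
      exact_mod_cast this
  obtain ⟨i⟩ := hd.nonempty
  have hsys := isHittingSystem_corona hh q hd.sum_deg
  refine ⟨⟨Sum.inl i⟩, ?_, hpos, ?_, coronaHitting G q m h, hsys, fun x => ?_⟩
  · rw [Fintype.card_sum, Fintype.card_prod, Fintype.card_fin, ← hE, ← hd.card]
    push_cast
    ring
  · rw [Fintype.sum_sum_type]
    simp only [deg_corona_inl, deg_corona_inr, ← Finset.mul_sum, hd.sum_deg, Finset.sum_const,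
      Finset.card_univ, Fintype.card_prod, Fintype.card_fin, nsmul_eq_mul]
    push_cast
    rw [hE]
    ring
  -- The weighted sum is independent of the start, so only an old starting vertex need be computed.
  · rw [hsys.sum_deg_mul_eq hpos x (Sum.inl i), Fintype.sum_sum_type, Fintype.sum_prod_type]
    have hA : ∑ f : G.edgeSet, endSum (h i) (f : Sym2 V) = S := by
      rw [sum_edges_endSum G (fun u _ => h i u), ← hS i]
      simp only [nbrSum_const, mul_comm]
    -- Foster's identity: the equation at the target gives 2m - d_u for the hitting times to u
    -- summed over its neighbours; then sum over u.
    have hC : ∑ f : G.edgeSet, endSum (fun u => endSum (h u) f) (f : Sym2 V) =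
        2 * m * (n - 1) := by
      rw [sum_edges_endSum G (fun u f => endSum (h u) f)]
      have h1 : ∀ u, nbrSum G (fun k => endSum (h u) s(u, k)) u = nbrSum G (h u) u := by
        intro u
        refine Finset.sum_congr rfl fun k _ => ?_
        split_ifs with huk
        · exact (endSum_mk _ huk.ne).trans (by rw [hh.diag, zero_add])
        · rfl
      have h2 : ∀ u, nbrSum G (fun k => h k u) u = 2 * m - deg G u := by
        intro u
        have := hh.step_all u u
        rw [hh.diag, if_pos rfl, hd.sum_deg] at this
        linarith
      simp only [h1]
      rw [sum_nbrSum_swap]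
      simp only [h2, Finset.sum_sub_distrib, hd.sum_deg, Finset.sum_const, Finset.card_univ,
        nsmul_eq_mul, hd.card]
      ring
    have h3 : ∑ j, (deg (cliqueCorona G q) (Sum.inl j) : ℝ) *
        coronaHitting G q m h (Sum.inl i) (Sum.inl j) = ((q : ℝ) + 1) ^ 2 * S := by
      rw [← hS i, Finset.mul_sum]
      refine Finset.sum_congr rfl fun j _ => ?_
      rw [deg_corona_inl]
      simp only [coronaHitting]
      ring
    rw [h3]
    simp only [deg_corona_inr, coronaHitting, coronaToEdge, Finset.sum_const, Finset.card_univ,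
      Fintype.card_fin, nsmul_eq_mul, ← Finset.mul_sum, Finset.sum_add_distrib,
      Finset.sum_sub_distrib, ← Finset.sum_div, hA, hC, hE]
    ring

end CoronaHitting

/-! ### Solving the recursion for `netGraph` -/

/-- Allows the `Fintype` instance to change: the one on `NetVertex` comes from finiteness, not from
the sum type. -/
theorem HasWalkData.congr {V : Type} {G : SimpleGraph V} {inst inst' : Fintype V}
    {n m S n' m' S' : ℝ} (hd : @HasWalkData V inst G n m S) (hn : n' = n) (hm : m' = m)
    (hS : S' = S) : @HasWalkData V inst' G n' m' S' := by
  rw [hn, hm, hS]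
  convert hd

/-- With M = (q+1)(q+2)/2, the recursion for S has homogeneous ratio (q+1)M, and its forcing term
m(3m-n) is a combination of M^g and M^(2g). This explains the three exponentials. -/
theorem hasWalkData_netGraph (q g : ℕ) :
    HasWalkData (netGraph q g)
      ((q : ℝ) + 2 + ((q : ℝ) + 1) * (q + 2) / (q + 3) *
        ((((q : ℝ) + 1) * (q + 2) / 2) ^ g - 1))
      ((((q : ℝ) + 1) * (q + 2) / 2) ^ (g + 1))
      (-(((q : ℝ) + 4) * (q + 1) ^ 2 / 2) * (((q : ℝ) + 1) ^ 2 * (q + 2) / 2) ^ g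
        + ((q : ℝ) + 2) * (q + 1) ^ 2 / (q + 3) * (((q : ℝ) + 1) * (q + 2) / 2) ^ g
        + (3 * (q : ℝ) + 7) * (q + 2) * (q + 1) ^ 2 / (2 * (q + 3)) *
          ((((q : ℝ) + 1) * (q + 2) / 2) ^ g) ^ 2) := by
  have hq3 : (q : ℝ) + 3 ≠ 0 := by positivity
  induction g with
  | zero =>
    refine (hasWalkData_top q).congr (V := NetVertex q 0) ?_ ?_ ?_
    · simp
    · simp
    · field_simp
      ring
  | succ g ih =>
    let _ : Fintype (netGraph q g).edgeSet := Fintype.ofFinite _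
    refine (ih.corona q).congr (V := NetVertex q (g + 1)) ?_ ?_ ?_
    · rw [pow_succ]
      field_simp
      ring
    · rw [pow_succ _ (g + 1)]
      ring
    · simp only [pow_succ]
      generalize (((q : ℝ) + 1) * (q + 2) / 2) ^ g = x
      generalize (((q : ℝ) + 1) ^ 2 * (q + 2) / 2) ^ g = y
      field_simp
      ring

theorem mainTheorem6 (q : ℕ) (hq : 1 ≤ q) (g : ℕ) :
    (∀ i j : NetVertex q g, hittingTime (netGraph q g) i j ≠ ∞) ∧
    multDegreeHittingSum (netGraph q g) =
      -((((q : ℝ) + 2) * ((q : ℝ) + 4) * ((q : ℝ) + 1) ^ 3) / 2)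
          * ((((q : ℝ) + 2) ^ 2 * ((q : ℝ) + 1) ^ 3) / 4) ^ g
        + ((((q : ℝ) + 2) ^ 2 * ((q : ℝ) + 1) ^ 3) / ((q : ℝ) + 3))
          * ((((q : ℝ) + 1) * ((q : ℝ) + 2)) / 2) ^ (2 * g)
        + (((3 * (q : ℝ) + 7) * ((q : ℝ) + 2) ^ 2 * ((q : ℝ) + 1) ^ 3) / (2 * ((q : ℝ) + 3)))
          * ((((q : ℝ) + 1) * ((q : ℝ) + 2)) / 2) ^ (3 * g) := by
  have hd := hasWalkData_netGraph q g
  refine ⟨hd.hittingTime_ne_top, ?_⟩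
  have hq3 : (q : ℝ) + 3 ≠ 0 := by positivity
  -- The factor m of 2mS multiplies the homogeneous ratio (q+1)M by M.
  have h1 : ((((q : ℝ) + 2) ^ 2 * ((q : ℝ) + 1) ^ 3) / 4) ^ g =
      (((q : ℝ) + 1) * (q + 2) / 2) ^ g * (((q : ℝ) + 1) ^ 2 * (q + 2) / 2) ^ g := by
    rw [← mul_pow]
    congr 1
    ring
  rw [hd.multDegreeHittingSum_eq, h1, mul_comm 2 g, mul_comm 3 g, pow_mul, pow_mul, pow_succ]
  generalize (((q : ℝ) + 1) * (q + 2) / 2) ^ g = x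
  generalize (((q : ℝ) + 1) ^ 2 * (q + 2) / 2) ^ g = y
  field_simp
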